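/- Let $R$ be an associative ring with $1$ and $L$ a nonzero unital left $R$-module. For $n\ge 0$ regard elements of the right $R$-module $R^n$ as columns; for $x\in R^n$ let $xL=\{(x_1l,\dots,x_nl)^{T}\mid l\in L\}\subseteq L^n$, and for an $n\times m$ matrix $A$ over $R$ let $AL^m=\{Al\mid l\in L^m\}\subseteq L^n$, with $L^m$ viewed as columns. For $S\subseteq R^n$, let $\sum_{s\in S}sL$ denote the sum of additive subgroups of $L^n$ (zero if $S=\emptyset$), and put $$\mathrm{cl}_{R^n}(S)=\{x\in R^n\mid xL\subseteq \textstyle\sum_{s\in S}sL\}.$$ Then the following hold. (a) For every $n\ge 0$, $\mathrm{cl}_{R^n}$ is a closure operator on the set $R^n$ (that is, $S\subseteq T$ implies $\mathrm{cl}(S)\subseteq\mathrm{cl}(T)$; $S\subseteq\mathrm{cl}(S)$; and $\mathrm{cl}(\mathrm{cl}(S))=\mathrm{cl}(S)$) whose closed subsets are right $R$-submodules of $R^n$. (b) For every $n>0$, $\mathrm{cl}_{R^n}(\emptyset)$ is a proper submodule of $R^n$. (c) For all $m,n\ge 0$, every homomorphism of right $R$-modules $h:R^m\to R^n$ and every $\mathrm{cl}_{R^n}$-closed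 submodule $A\subseteq R^n$, the submodule $h^{-1}(A)$ is $\mathrm{cl}_{R^m}$-closed. (d) For each $n\ge 0$ the following five conditions are equivalent: 1. (exchange) for all $S\subseteq R^n$ and $t,u\in R^n$, if $u\notin\mathrm{cl}_{R^n}(S)$ but $u\in\mathrm{cl}_{R^n}(S\cup\{t\})$, then $t\in\mathrm{cl}_{R^n}(S\cup\{u\})$; 2. the condition in 1 restricted to sets $S$ of cardinality $<n$; 3. there do not exist a subset $S\subseteq R^n$ and elements $u,t\in R^n$ such that $\sum_{s\in S}sL\subsetneqq\sum_{s\in S\cup\{u\}}sL\subsetneqq\sum_{s\in S\cup\{t\}}sL$; 4. there do not exist an $n\times(n-1)$ matrix $A$ and $n\times n$ matrices $B$, $C$ over $R$, each obtained by adding a single column to $A$, such that $AL^{n-1}\subsetneqq BL^n\subsetneqq CL^n$ (for $n=0$ this condition holds vacuously); 5. there do not exist $n\times n$ matrices $A,B,C$ over $R$ which all agree except in one column, such that $AL^n\subsetneqq BL^n\subsetneqq CL^n$. (e) If, moreover, $L$ is faithful and satisfies 3 for all $n\ge 0$ (equivalently, 4 for all $n\geq 0$; equivalently, 5 for all $n\ge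 0$), then $R$ is embeddable in a division ring, that is, there is an injective unital ring homomorphism from $R$ to a division ring. -/

import Mathlib

universe u v

namespace ClosureStructures

section Operators

/-- `cl` is a closure operator on the set `X`: monotone, extensive and idempotent. -/
def IsClosureOperator {X : Type*} (cl : Set X → Set X) : Prop :=
  (∀ S T : Set X, S ⊆ T → cl S ⊆ cl T) ∧ (∀ S : Set X, S ⊆ cl S) ∧
    (∀ S : Set X, cl (cl S) = cl S)

variable {R : Type u} [Ring R]

/-- `cl` is a closure operator on the underlying set of the right `R`-module `R ^ n`
(a right `R`-module is a module over `Rᵐᵒᵖ`), and its closed subsets are right submodules. -/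
def ClosureCondition {n : ℕ} (cl : Set (Fin n → R) → Set (Fin n → R)) : Prop :=
  IsClosureOperator cl ∧
    ∀ S : Set (Fin n → R), cl S = S →
      ∃ A : Submodule Rᵐᵒᵖ (Fin n → R), (A : Set (Fin n → R)) = S

/-- For all `n > 0`, the closure of the empty set is a proper right submodule of `R ^ n`. -/
def Properness (cl : ∀ n : ℕ, Set (Fin n → R) → Set (Fin n → R)) : Prop :=
  ∀ n : ℕ, 0 < n →
    ∃ A : Submodule Rᵐᵒᵖ (Fin n → R), (A : Set (Fin n → R)) = cl n ∅ ∧ A ≠ ⊤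

/-- The inverse image of a closed submodule under a homomorphism of right `R`-modules
`R ^ m → R ^ n` is closed. -/
def Coherence (cl : ∀ n : ℕ, Set (Fin n → R) → Set (Fin n → R)) : Prop :=
  ∀ (m n : ℕ) (h : (Fin m → R) →ₗ[Rᵐᵒᵖ] (Fin n → R)) (A : Submodule Rᵐᵒᵖ (Fin n → R)),
    cl n (A : Set (Fin n → R)) = (A : Set (Fin n → R)) →
      cl m (h ⁻¹' (A : Set (Fin n → R))) = h ⁻¹' (A : Set (Fin n → R))

/-- The exchange property of an operator on subsets of `X`. -/
def Exchange {X : Type*} (cl : Set X → Set X) : Prop :=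
  ∀ (S : Set X) (t u : X), u ∉ cl S → u ∈ cl (S ∪ {t}) → t ∈ cl (S ∪ {u})

/-- The exchange property restricted to sets `S` of cardinality less than `n`. -/
def ExchangeBelow {X : Type*} (n : ℕ) (cl : Set X → Set X) : Prop :=
  ∀ (S : Set X) (t u : X), S.encard < n →
    u ∉ cl S → u ∈ cl (S ∪ {t}) → t ∈ cl (S ∪ {u})

end Operators

section LeftModule

variable {R : Type u} [Ring R] (L : Type v) [AddCommGroup L] [Module R L]

/-- The additive map `L ^ m → L ^ n`, `l ↦ A l`, given by an `n × m` matrix `A` over `R`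
acting from the left on columns over `L`. -/
def matMap {n m : ℕ} (A : Matrix (Fin n) (Fin m) R) : (Fin m → L) →+ (Fin n → L) where
  toFun l := fun i => ∑ j, A i j • l j
  map_zero' := by ext i; simp
  map_add' l l' := by ext i; simp [Finset.sum_add_distrib]

/-- `A L ^ m`, the image of the matrix `A`. -/
def matImage {n m : ℕ} (A : Matrix (Fin n) (Fin m) R) : AddSubgroup (Fin n → L) :=
  (matMap L A).range

/-- The additive map `L → L ^ n`, `l ↦ x l`, given by a column `x ∈ R ^ n`. -/
def colMap {n : ℕ} (x : Fin n → R) : L →+ (Fin n → L) where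
  toFun l := fun i => x i • l
  map_zero' := by ext i; simp
  map_add' l l' := by ext i; simp

/-- `x L`, the image of the column `x`. -/
def colImage {n : ℕ} (x : Fin n → R) : AddSubgroup (Fin n → L) :=
  (colMap L x).range

/-- `∑_{s ∈ S} s L`, a sum of additive subgroups of `L ^ n`. -/
def sumImage {n : ℕ} (S : Set (Fin n → R)) : AddSubgroup (Fin n → L) :=
  ⨆ s ∈ S, colImage L s

/-- The operator `cl_{R ^ n}` induced by the left module `L`. -/
def clL (n : ℕ) (S : Set (Fin n → R)) : Set (Fin n → R) :=
  {x | colImage L x ≤ sumImage L S}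

variable (R)

/-- There are no `S ⊆ R ^ n` and `u, t ∈ R ^ n` with
`∑_{s ∈ S} s L ⊊ ∑_{s ∈ S ∪ {u}} s L ⊊ ∑_{s ∈ S ∪ {t}} s L`. -/
def NoChainOfSets (n : ℕ) : Prop :=
  ¬ ∃ (S : Set (Fin n → R)) (u t : Fin n → R),
    sumImage L S < sumImage L (S ∪ {u}) ∧ sumImage L (S ∪ {u}) < sumImage L (S ∪ {t})

variable {R} in
/-- `B` is obtained from `A` by adding a single column (in some position). -/
def AddsColumn {n k : ℕ} (A : Matrix (Fin n) (Fin k) R) (B : Matrix (Fin n) (Fin (k + 1)) R) :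
    Prop :=
  ∃ j : Fin (k + 1), ∀ (i : Fin n) (l : Fin k), B i (j.succAbove l) = A i l

/-- There are no `n × (n - 1)` matrix `A` and `n × n` matrices `B`, `C`, each obtained by adding
a single column to `A`, with `A L ^ (n - 1) ⊊ B L ^ n ⊊ C L ^ n`. The number `n - 1` is called
`k`; for `n = 0` there are no such matrices. -/
def NoChainOfAddedColumns (n : ℕ) : Prop :=
  ∀ k : ℕ, n = k + 1 →
    ¬ ∃ (A : Matrix (Fin n) (Fin k) R) (B C : Matrix (Fin n) (Fin (k + 1)) R),
      AddsColumn A B ∧ AddsColumn A C ∧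
        matImage L A < matImage L B ∧ matImage L B < matImage L C

/-- There are no `n × n` matrices `A`, `B`, `C` which all agree except in one column, with
`A L ^ n ⊊ B L ^ n ⊊ C L ^ n`. -/
def NoChainOfSquareMatrices (n : ℕ) : Prop :=
  ¬ ∃ A B C : Matrix (Fin n) (Fin n) R,
    (∃ j : Fin n, ∀ i l : Fin n, l ≠ j → A i l = B i l ∧ B i l = C i l) ∧
      matImage L A < matImage L B ∧ matImage L B < matImage L C

end LeftModule

end ClosureStructures

/-! Translating inclusions of sums into membership in closures, conditions 3, 4 and 5 are exchange
for, respectively, arbitrary sets, the columns of an `n × (n - 1)` matrix, and the same with a zero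
column added. Passing from small sets to all sets is a Steinitz argument: `R ^ n` is the closure of
its `n` basis columns, so every set has the same closure as a subset of fewer than `n` of its
elements or else closure everything (`ExchangeBelow.exists_finset_subset`).

For the embedding, let `E = Hom(L, ℚ/ℤ)`, a right module. Characters separate points from subgroups
of `L ^ n`, so `x` lies in the closure of `S` exactly when every right linear map `R ^ n → E`
killing `S` kills `x` (`mem_clL_iff_entails`). A hyperplane with a base point off it should be the
kernel of a map to the future division ring `D` sending the base point to `1`. Exchange lets two
such data be glued inside a direct sum (`Hyperplane.exists_amalgam`), so finitely many are realized
together in `E`; a reduced power of `E` then realizes all of them at once (`exists_realization`).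
The values of these maps form a right module `X` on which `D = End X` acts simply transitively from
the distinguished element `one`: endomorphisms are determined by their value there, every value
occurs, and nonzero ones are invertible because exchange lets any vector off a hyperplane become its
base point. Finally `r ↦ (one ↦ one * r)` embeds `R`, by faithfulness. -/

namespace ClosureStructures

/-! ### Steinitz replacement: exchange for small sets implies exchange. -/

section Steinitz

variable {X : Type*} {cl : Set X → Set X}

theorem IsClosureOperator.subset_of_subset (hcl : IsClosureOperator cl) {S T : Set X}
    (h : S ⊆ cl T) : cl S ⊆ cl T :=
  (hcl.1 _ _ h).trans (hcl.2.2 T).subset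

theorem exists_critical_element {P : Set X → Prop} (W : Finset X) (h₀ : ¬ P ∅) (h : P W) :
    ∃ w ∈ W, ∃ V : Set X, V ⊆ W ∧ w ∉ V ∧ ¬ P V ∧ P (insert w V) := by
  classical
  induction W using Finset.induction_on with
  | empty => simp only [Finset.coe_empty] at h; exact absurd h h₀
  | insert a W ha ih =>
    by_cases hW : P W
    · obtain ⟨w, hw, V, hV, h⟩ := ih hW
      exact ⟨w, Finset.mem_insert_of_mem hw, V,
        hV.trans (by simp), h⟩
    · exact ⟨a, Finset.mem_insert_self _ _, W, by simp, by simpa using ha, hW, by simpa using h⟩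

/-- Add elements of `W` to `T` one at a time until `k` enters the closure; the element `w` added at
that moment can be exchanged for `k`. The set present just before omits `w`, hence has fewer than
`n` elements, so restricted exchange suffices. -/
theorem ExchangeBelow.exists_replacement {n : ℕ} (hcl : IsClosureOperator cl)
    (hex : ExchangeBelow n cl) [DecidableEq X] (T W : Finset X) (hn : T.card + W.card ≤ n)
    (htop : cl (T ∪ W : Set X) = Set.univ) (k : X) (hk : k ∉ cl T) :
    ∃ w ∈ W, cl (insert k T ∪ W.erase w : Set X) = Set.univ := by
  obtain ⟨w, hw, V, hV, hwV, h1, h2⟩ :=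
    exists_critical_element (P := fun V => k ∈ cl (T ∪ V)) W (by simpa using hk)
      (by simp [htop])
  refine ⟨w, hw, ?_⟩
  have hVe : V ⊆ (W.erase w : Set X) := by
    intro x hx
    simp only [Finset.coe_erase]
    exact ⟨hV hx, by rintro rfl; exact hwV hx⟩
  have hcard : (T ∪ V : Set X).encard < n := by
    have hlt : T.card + (W.erase w).card < n := by
      have := Finset.card_erase_lt_of_mem hw
      omega
    refine lt_of_le_of_lt ?_ (Nat.cast_lt.mpr hlt)
    refine (Set.encard_le_encard (Set.union_subset_union_right _ hVe)).trans ?_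
    refine (Set.encard_union_le _ _).trans ?_
    rw [Set.encard_coe_eq_coe_finsetCard, Set.encard_coe_eq_coe_finsetCard, Nat.cast_add]
  have hwcl : w ∈ cl (T ∪ V ∪ {k}) :=
    hex _ w k hcard h1 (by rwa [Set.union_assoc, Set.union_singleton])
  have hsub : (T ∪ V ∪ {k} : Set X) ⊆ (insert k T ∪ W.erase w : Set X) := by
    rintro x ((hx | hx) | hx)
    · exact Or.inl (Or.inr hx)
    · exact Or.inr (hVe hx)
    · exact Or.inl (Or.inl hx)
  rw [Set.eq_univ_iff_forall] at htop ⊢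
  intro x
  refine hcl.subset_of_subset ?_ (htop x)
  rintro y (hy | hy)
  · exact hcl.2.1 _ (Or.inl (Or.inr hy))
  · by_cases hyw : y = w
    · rw [hyw]; exact hcl.1 _ _ hsub hwcl
    · exact hcl.2.1 _ (Or.inr (by simpa [hyw] using hy))

/-- Elements of `K` replace those of the spanning set until `K` lies in the closure of those already
chosen, or nothing of the old set is left and the chosen ones span. -/
theorem ExchangeBelow.exists_finset_subset {n : ℕ} (hcl : IsClosureOperator cl)
    (hex : ExchangeBelow n cl) (T₀ : Finset X) (hT₀ : T₀.card ≤ n) (htop : cl T₀ = Set.univ)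
    (K : Set X) :
    ∃ T : Finset X, (T : Set X) ⊆ K ∧ K ⊆ cl T ∧ (T.card < n ∨ cl T = Set.univ) := by
  classical
  suffices H : ∀ (m : ℕ) (T W : Finset X), W.card = m → (T : Set X) ⊆ K → T.card + W.card ≤ n →
      cl (T ∪ W : Set X) = Set.univ →
      ∃ T : Finset X, (T : Set X) ⊆ K ∧ K ⊆ cl T ∧ (T.card < n ∨ cl T = Set.univ) from
    H _ ∅ T₀ rfl (by simp) (by simpa using hT₀) (by simpa using htop)
  intro m
  induction m with
  | zero =>
    intro T W hW hT _ ht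
    rw [Finset.card_eq_zero] at hW
    subst hW
    rw [Finset.coe_empty, Set.union_empty] at ht
    exact ⟨T, hT, by simp [ht], Or.inr ht⟩
  | succ m ih =>
    intro T W hW hT hn ht
    by_cases hK : K ⊆ cl T
    · exact ⟨T, hT, hK, Or.inl (by omega)⟩
    · obtain ⟨k, hkK, hk⟩ := Set.not_subset.mp hK
      obtain ⟨w, hw, h⟩ := hex.exists_replacement hcl T W hn ht k hk
      have hWe := Finset.card_erase_of_mem hw
      have hTi := Finset.card_insert_le k T
      refine ih (insert k T) (W.erase w) (by omega) ?_ (by omega) (by simpa using h)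
      rw [Finset.coe_insert]
      exact Set.insert_subset hkK hT

theorem ExchangeBelow.exchange {n : ℕ} (hcl : IsClosureOperator cl)
    (hex : ExchangeBelow n cl) (T₀ : Finset X) (hT₀ : T₀.card ≤ n) (htop : cl T₀ = Set.univ) :
    Exchange cl := by
  intro S t u hu hut
  obtain ⟨T, hTS, hST, hT⟩ := hex.exists_finset_subset hcl T₀ hT₀ htop S
  have huT : u ∉ cl T := fun h => hu (hcl.1 _ _ hTS h)
  rcases hT with hT | hT
  · refine hcl.1 _ _ (Set.union_subset_union_left _ hTS) (hex T t u (by simpa using hT) huT ?_)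
    refine hcl.subset_of_subset (Set.union_subset ?_ ?_) hut
    · exact hST.trans (hcl.1 _ _ Set.subset_union_left)
    · exact Set.subset_union_right.trans (hcl.2.1 _)
  · exact absurd (hT ▸ Set.mem_univ u) huT

end Steinitz

/-! ### The closure operator of a left module, and its matrix forms. -/

section LeftModule

variable {R : Type u} [Ring R] (L : Type v) [AddCommGroup L] [Module R L]

theorem colImage_le_sumImage {n : ℕ} {S : Set (Fin n → R)} {s : Fin n → R} (hs : s ∈ S) :
    colImage L s ≤ sumImage L S :=
  le_iSup₂_of_le s hs le_rfl

theorem sumImage_le {n : ℕ} {S : Set (Fin n → R)} {A : AddSubgroup (Fin n → L)} :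
    sumImage L S ≤ A ↔ ∀ s ∈ S, colImage L s ≤ A :=
  iSup₂_le_iff

theorem sumImage_mono {n : ℕ} {S T : Set (Fin n → R)} (h : S ⊆ T) :
    sumImage L S ≤ sumImage L T :=
  (sumImage_le L).2 fun _ hs => colImage_le_sumImage L (h hs)

theorem sumImage_le_iff_subset_clL {n : ℕ} {S T : Set (Fin n → R)} :
    sumImage L S ≤ sumImage L T ↔ S ⊆ clL L n T :=
  sumImage_le L

theorem sumImage_union_singleton_le {n : ℕ} {S T : Set (Fin n → R)} {x : Fin n → R}
    (h : S ⊆ T) : sumImage L (S ∪ {x}) ≤ sumImage L T ↔ x ∈ clL L n T := by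
  rw [sumImage_le_iff_subset_clL]
  constructor
  · exact fun hx => hx (Or.inr rfl)
  · rintro hx y (hy | rfl)
    · exact colImage_le_sumImage L (h hy)
    · exact hx

theorem isClosureOperator_clL (n : ℕ) : IsClosureOperator (clL (R := R) L n) := by
  have hext : ∀ S : Set (Fin n → R), S ⊆ clL L n S := fun S _ hs => colImage_le_sumImage L hs
  refine ⟨fun S T h x hx => ?_, hext, fun S => ?_⟩
  · exact le_trans (show colImage L x ≤ _ from hx) (sumImage_mono L h)
  refine Set.Subset.antisymm (fun x hx => ?_) (hext _)
  refine le_trans (show colImage L x ≤ _ from hx) ?_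
  exact (sumImage_le L).2 fun s hs => hs

/-- The closure of a set of columns, as a right submodule. -/
def clLSubmodule (n : ℕ) (S : Set (Fin n → R)) : Submodule Rᵐᵒᵖ (Fin n → R) where
  carrier := clL L n S
  zero_mem' := by
    rintro _ ⟨l, rfl⟩
    convert (sumImage L S).zero_mem
    ext i
    simp [colMap]
  add_mem' := by
    rintro x y hx hy _ ⟨l, rfl⟩
    convert (sumImage L S).add_mem (hx ⟨l, rfl⟩) (hy ⟨l, rfl⟩)
    ext i
    simp [colMap, add_smul]
  smul_mem' := by
    rintro r x hx _ ⟨l, rfl⟩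
    have h : colMap L (r • x) l = colMap L x (r.unop • l) := by
      ext i
      simp [colMap, mul_smul]
    rw [h]
    exact hx ⟨_, rfl⟩

theorem closureCondition_clL (n : ℕ) : ClosureCondition (R := R) (clL L n) :=
  ⟨isClosureOperator_clL L n, fun S hS => ⟨clLSubmodule L n S, hS⟩⟩

theorem mem_clL_empty {n : ℕ} {x : Fin n → R} :
    x ∈ clL L n ∅ ↔ ∀ (l : L) (i : Fin n), x i • l = 0 := by
  simp only [clL, sumImage, Set.mem_ofPred_eq, Set.mem_empty_iff_false, iSup_false, iSup_bot,
    le_bot_iff, AddSubgroup.eq_bot_iff_forall]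
  constructor
  · exact fun h l i => congrFun (h _ ⟨l, rfl⟩) i
  · rintro h _ ⟨l, rfl⟩
    exact funext (h l)

theorem properness_clL [Nontrivial L] : Properness (R := R) (clL L) := by
  intro n hn
  refine ⟨clLSubmodule L n ∅, rfl, fun h => ?_⟩
  obtain ⟨l, hl⟩ := exists_ne (0 : L)
  have h1 : (1 : Fin n → R) ∈ clLSubmodule L n (∅ : Set (Fin n → R)) := h ▸ Submodule.mem_top
  have := (mem_clL_empty L).1 h1 l ⟨0, hn⟩
  exact hl (by simpa using this)

theorem rightLinearMap_apply {M : Type*} [AddCommGroup M] [Module Rᵐᵒᵖ M] {m : ℕ}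
    (h : (Fin m → R) →ₗ[Rᵐᵒᵖ] M) (x : Fin m → R) :
    h x = ∑ j, MulOpposite.op (x j) • h (Pi.single j 1) := by
  conv_lhs => rw [← Finset.univ_sum_single x]
  rw [map_sum]
  refine Finset.sum_congr rfl fun j _ => ?_
  rw [← map_smul]
  congr 1
  ext i
  by_cases hij : i = j
  · subst hij; simp
  · simp [hij]

/-- A right linear map is left multiplication by a matrix, which also acts on columns over `L`;
coherence follows by pulling sums back along this action. -/
theorem colMap_rightLinearMap {m n : ℕ} (h : (Fin m → R) →ₗ[Rᵐᵒᵖ] (Fin n → R)) (x : Fin m → R)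
    (l : L) :
    colMap L (h x) l =
      matMap L (Matrix.of fun i j => h (Pi.single j 1) i) (colMap L x l) := by
  ext i
  simp [colMap, matMap, rightLinearMap_apply h x, Finset.sum_apply, Finset.sum_smul, mul_smul]

theorem coherence_clL : Coherence (R := R) (clL L) := by
  intro m n h A hA
  refine Set.Subset.antisymm (fun x hx => ?_) ((isClosureOperator_clL L m).2.1 _)
  change h x ∈ (A : Set (Fin n → R))
  rw [← hA]
  have key : sumImage L (h ⁻¹' (A : Set (Fin n → R))) ≤
      (sumImage L (A : Set (Fin n → R))).comap
        (matMap L (Matrix.of fun i j => h (Pi.single j 1) i)) := by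
    rw [sumImage_le]
    rintro s hs _ ⟨l, rfl⟩
    rw [AddSubgroup.mem_comap, ← colMap_rightLinearMap]
    exact colImage_le_sumImage L (show h s ∈ (A : Set (Fin n → R)) from hs) ⟨l, rfl⟩
  rintro _ ⟨l, rfl⟩
  rw [colMap_rightLinearMap]
  exact key (hx ⟨l, rfl⟩)

theorem sumImage_range_col {n m : ℕ} (A : Matrix (Fin n) (Fin m) R) :
    sumImage L (Set.range fun j i => A i j) = matImage L A := by
  refine le_antisymm ((sumImage_le L).2 ?_) ?_
  · rintro _ ⟨j, rfl⟩ _ ⟨l, rfl⟩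
    refine ⟨Pi.single j l, ?_⟩
    ext i
    simp [matMap, colMap, Pi.single_apply]
  · rintro _ ⟨l, rfl⟩
    have : matMap L A l = ∑ j, colMap L (fun i => A i j) (l j) := by
      ext i
      simp [matMap, colMap]
    rw [this]
    exact AddSubgroup.sum_mem _ fun j _ => colImage_le_sumImage L (Set.mem_range_self j) ⟨l j, rfl⟩

theorem range_eq_union_succAbove {α : Type*} {k : ℕ} (f : Fin (k + 1) → α) (j : Fin (k + 1)) :
    Set.range f = (Set.range fun l => f (j.succAbove l)) ∪ {f j} := by
  ext x
  constructor
  · rintro ⟨i, rfl⟩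
    rcases Fin.eq_self_or_eq_succAbove j i with rfl | ⟨l, rfl⟩
    · exact Or.inr rfl
    · exact Or.inl ⟨l, rfl⟩
  · rintro (⟨l, rfl⟩ | rfl)
    · exact ⟨_, rfl⟩
    · exact ⟨_, rfl⟩

theorem AddsColumn.exists_matImage_eq {n k : ℕ} {A : Matrix (Fin n) (Fin k) R}
    {B : Matrix (Fin n) (Fin (k + 1)) R} (h : AddsColumn A B) :
    ∃ x, matImage L B = sumImage L ((Set.range fun j i => A i j) ∪ {x}) := by
  obtain ⟨j, hj⟩ := h
  refine ⟨fun i => B i j, ?_⟩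
  rw [← sumImage_range_col, range_eq_union_succAbove _ j]
  simp only [hj]

/-- The matrix with first column `x` and remaining columns those of `A`. -/
def consColumn {n k : ℕ} (x : Fin n → R) (A : Matrix (Fin n) (Fin k) R) :
    Matrix (Fin n) (Fin (k + 1)) R :=
  Matrix.of fun i => Fin.cons (x i) (A i)

theorem addsColumn_consColumn {R : Type*} {n k : ℕ} (x : Fin n → R) (A : Matrix (Fin n) (Fin k) R) :
    AddsColumn A (consColumn x A) :=
  ⟨0, fun i l => by simp [consColumn]⟩

theorem matImage_consColumn {n k : ℕ} (x : Fin n → R) (A : Matrix (Fin n) (Fin k) R) :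
    matImage L (consColumn x A) = sumImage L ((Set.range fun j i => A i j) ∪ {x}) := by
  rw [← sumImage_range_col, range_eq_union_succAbove _ 0]
  simp [consColumn]

theorem AddsColumn.matImage_le {n k : ℕ} {A : Matrix (Fin n) (Fin k) R}
    {B : Matrix (Fin n) (Fin (k + 1)) R} (h : AddsColumn A B) : matImage L A ≤ matImage L B := by
  obtain ⟨x, hx⟩ := h.exists_matImage_eq L
  rw [hx, ← sumImage_range_col]
  exact sumImage_mono L Set.subset_union_left

theorem exists_matrix_matImage_eq {n k : ℕ} (T : Finset (Fin n → R)) (hT : T.card ≤ k) :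
    ∃ A : Matrix (Fin n) (Fin k) R, ((T : Set (Fin n → R)) ⊆ Set.range fun j i => A i j) ∧
      (Set.range fun j i => A i j) ⊆ clL L n T := by
  -- Padding by zero columns is harmless, since `0` lies in every closure.
  refine ⟨Matrix.of fun i j => if h : (j : ℕ) < T.card then (T.equivFin.symm ⟨j, h⟩ : Fin n → R) i else 0,
    ?_, ?_⟩
  · intro x hx
    refine ⟨⟨T.equivFin ⟨x, hx⟩, (T.equivFin ⟨x, hx⟩).2.trans_le hT⟩, ?_⟩
    ext i
    simp
  · rintro _ ⟨j, rfl⟩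
    by_cases h : (j : ℕ) < T.card
    · simp only [Matrix.of_apply, h, dif_pos]
      exact (isClosureOperator_clL L n).2.1 _ (T.equivFin.symm ⟨j, h⟩).2
    · simp only [Matrix.of_apply, h, dif_neg, not_false_eq_true]
      exact (clLSubmodule L n (T : Set (Fin n → R))).zero_mem

theorem exists_finset_clL_eq_univ (n : ℕ) :
    ∃ T : Finset (Fin n → R), T.card ≤ n ∧ clL L n (T : Set (Fin n → R)) = Set.univ := by
  classical
  refine ⟨Finset.univ.image fun i => Pi.single i 1, ?_, ?_⟩
  · exact Finset.card_image_le.trans (by simp)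
  · rw [Set.eq_univ_iff_forall]
    rintro x
    have := rightLinearMap_apply LinearMap.id x
    change x ∈ clLSubmodule L n _
    rw [LinearMap.id_apply] at this
    rw [this]
    refine Submodule.sum_mem _ fun j _ => Submodule.smul_mem _ _ ?_
    exact (isClosureOperator_clL L n).2.1 _ (by simp)

theorem exchange_clL_tfae (n : ℕ) : List.TFAE
      [Exchange (clL (R := R) L n), ExchangeBelow n (clL (R := R) L n), NoChainOfSets R L n,
       NoChainOfAddedColumns R L n, NoChainOfSquareMatrices R L n] := by
  tfae_have 1 → 3 := by
    rintro hex ⟨S, u, t, h1, h2⟩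
    refine h2.not_ge ((sumImage_union_singleton_le L Set.subset_union_left).2
      (hex S t u (fun hu => ?_) ?_))
    · exact h1.not_ge ((sumImage_union_singleton_le L subset_rfl).2 hu)
    · exact (sumImage_union_singleton_le L Set.subset_union_left).1 h2.le
  tfae_have 3 → 4 := by
    rintro h k rfl ⟨A, B, C, hB, hC, h1, h2⟩
    obtain ⟨u, hu⟩ := hB.exists_matImage_eq L
    obtain ⟨t, ht⟩ := hC.exists_matImage_eq L
    rw [hu, ht] at h2
    rw [hu, ← sumImage_range_col] at h1
    exact h ⟨_, u, t, h1, h2⟩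
  tfae_have 4 → 2 := by
    intro h S t u hS hu hut
    by_contra ht
    obtain ⟨k, rfl⟩ : ∃ k, n = k + 1 := by
      rcases n with _ | k
      · simp at hS
      · exact ⟨k, rfl⟩
    have hfin : S.Finite := Set.finite_of_encard_le_coe hS.le
    obtain ⟨T, rfl⟩ := hfin.exists_finset_coe
    have hcard : T.card < k + 1 := by
      rw [Set.encard_coe_eq_coe_finsetCard] at hS
      exact_mod_cast hS
    obtain ⟨A, hA1, hA2⟩ := exists_matrix_matImage_eq L T (Nat.le_of_lt_succ hcard)
    have hcl := isClosureOperator_clL (R := R) L (k + 1)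
    refine h k rfl ⟨A, consColumn u A, consColumn t A, addsColumn_consColumn u A,
      addsColumn_consColumn t A, ?_, ?_⟩
    · rw [matImage_consColumn, ← sumImage_range_col]
      refine lt_of_le_not_ge (sumImage_mono L Set.subset_union_left) fun hle => hu ?_
      exact hcl.subset_of_subset hA2 ((sumImage_union_singleton_le L subset_rfl).1 hle)
    · rw [matImage_consColumn, matImage_consColumn]
      refine lt_of_le_not_ge ?_ fun hle => ht ?_
      · rw [sumImage_union_singleton_le L Set.subset_union_left]
        exact hcl.1 _ _ (Set.union_subset_union_left _ hA1) hut
      · rw [sumImage_union_singleton_le L Set.subset_union_left] at hle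
        refine hcl.subset_of_subset (Set.union_subset ?_ ?_) hle
        · exact hA2.trans (hcl.1 _ _ Set.subset_union_left)
        · exact Set.subset_union_right.trans (hcl.2.1 _)
  tfae_have 2 → 1 := by
    intro h
    obtain ⟨T, hT, htop⟩ := exists_finset_clL_eq_univ (R := R) L n
    exact h.exchange (isClosureOperator_clL L n) T hT htop
  tfae_have 4 → 5 := by
    rintro h ⟨A, B, C, ⟨j, hj⟩, h1, h2⟩
    obtain ⟨k, rfl⟩ : ∃ k, n = k + 1 := by
      rcases n with _ | k
      · exact j.elim0
      · exact ⟨k, rfl⟩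
    have hne := fun l => Fin.succAbove_ne j l
    have hA : AddsColumn (Matrix.of fun i l => A i (j.succAbove l)) A := ⟨j, fun i l => rfl⟩
    refine h k rfl ⟨Matrix.of fun i l => A i (j.succAbove l), B, C,
      ⟨j, fun i l => ?_⟩, ⟨j, fun i l => ?_⟩, lt_of_le_of_lt (hA.matImage_le L) h1, h2⟩
    · exact (hj i _ (hne l)).1.symm
    · exact ((hj i _ (hne l)).1.trans (hj i _ (hne l)).2).symm
  tfae_have 5 → 4 := by
    rintro h k rfl ⟨A, B, C, hB, hC, h1, h2⟩
    obtain ⟨u, hu⟩ := hB.exists_matImage_eq L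
    obtain ⟨t, ht⟩ := hC.exists_matImage_eq L
    -- The added columns of `B` and `C` may sit in different positions; images ignore column order,
    -- so both are moved to the front.
    rw [hu, ht, ← matImage_consColumn, ← matImage_consColumn] at h2
    rw [hu, ← matImage_consColumn] at h1
    refine h ⟨consColumn 0 A, consColumn u A, consColumn t A, ⟨0, fun i l hl => ?_⟩, ?_, h2⟩
    · obtain ⟨l, rfl⟩ := Fin.exists_succ_eq.2 hl
      simp [consColumn]
    · refine lt_of_le_of_lt ?_ h1
      rw [matImage_consColumn, ← sumImage_range_col,
        sumImage_union_singleton_le L subset_rfl]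
      exact (clLSubmodule L (k + 1) _).zero_mem
  tfae_have 1 → 2 := fun h S t u _ => h S t u
  tfae_finish

end LeftModule

end ClosureStructures

namespace ClosureStructures

/-! ### Amalgamation of hyperplanes in free right modules. -/

section Fractions

open MulOpposite

/-- Every right linear map to `E` that kills `S` kills `x`. -/
def Entails (R : Type*) [Ring R] (E : Type*) [AddCommGroup E] [Module Rᵐᵒᵖ E] {V : Type*}
    [AddCommGroup V] [Module Rᵐᵒᵖ V] (S : Set V) (x : V) : Prop :=
  ∀ g : V →ₗ[Rᵐᵒᵖ] E, (∀ s ∈ S, g s = 0) → g x = 0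

/-- The exchange property of entailment in all `R ^ n`. -/
def EntailsExchange (R : Type*) [Ring R] (E : Type*) [AddCommGroup E] [Module Rᵐᵒᵖ E] : Prop :=
  ∀ (n : ℕ) (S : Set (Fin n → R)) (t u : Fin n → R),
    ¬ Entails R E S u → Entails R E (insert t S) u → Entails R E (insert u S) t

/-- Every subset of `R ^ n` is entailed by a finite subset of itself. -/
def EntailsFinite (R : Type*) [Ring R] (E : Type*) [AddCommGroup E] [Module Rᵐᵒᵖ E] : Prop :=
  ∀ (n : ℕ) (K : Set (Fin n → R)), ∃ T : Finset (Fin n → R), (T : Set (Fin n → R)) ⊆ K ∧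
    ∀ k ∈ K, Entails R E (T : Set (Fin n → R)) k

/-- Right linear maps from `R ^ n` to `X` respect entailment with respect to `E`. -/
def IsSeparated (R : Type*) [Ring R] (E : Type*) [AddCommGroup E] [Module Rᵐᵒᵖ E] (X : Type*)
    [AddCommGroup X] [Module Rᵐᵒᵖ X] : Prop :=
  ∀ (n : ℕ) (h : (Fin n → R) →ₗ[Rᵐᵒᵖ] X) (S : Set (Fin n → R)) (x : Fin n → R),
    (∀ s ∈ S, h s = 0) → Entails R E S x → h x = 0

/-- A set of relations on `R ^ n` whose closure is a hyperplane, with a base point off this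
hyperplane. -/
structure Hyperplane (R : Type u) [Ring R] (E : Type v) [AddCommGroup E] [Module Rᵐᵒᵖ E] where
  /-- The rank of the ambient free module. -/
  rank : ℕ
  /-- The relations. -/
  rel : Set (Fin rank → R)
  /-- The base point. -/
  base : Fin rank → R
  not_entails : ¬ Entails R E rel base
  entails : ∀ x, Entails R E (insert base rel) x

variable {R : Type u} [Ring R] {E : Type v} [AddCommGroup E] [Module Rᵐᵒᵖ E]

theorem IsSeparated.ext {X : Type*} [AddCommGroup X] [Module Rᵐᵒᵖ X] (hX : IsSeparated R E X)
    (b : Hyperplane R E) {g h : (Fin b.rank → R) →ₗ[Rᵐᵒᵖ] X} (hrel : ∀ m ∈ b.rel, g m = h m)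
    (hbase : g b.base = h b.base) : g = h := by
  refine LinearMap.ext fun x => ?_
  rw [← sub_eq_zero, ← LinearMap.sub_apply]
  refine hX _ _ _ _ ?_ (b.entails x)
  rintro s (rfl | hs)
  · simp [hbase]
  · simp [hrel s hs]

/-- The right linear map `R ^ n → E` with given values on the standard basis. -/
def ofBasisValues {n : ℕ} (v : Fin n → E) : (Fin n → R) →ₗ[Rᵐᵒᵖ] E where
  toFun x := ∑ j, op (x j) • v j
  map_add' x y := by simp [add_smul, Finset.sum_add_distrib]
  map_smul' r x := by simp [Finset.smul_sum, mul_smul]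

/-- The hyperplane `0` of `R`, with base point `1`. -/
def Hyperplane.unit [Nontrivial E] : Hyperplane R E where
  rank := 1
  rel := ∅
  base := 1
  not_entails h := by
    obtain ⟨e, he⟩ := exists_ne (0 : E)
    exact he (by simpa [ofBasisValues] using h (ofBasisValues fun _ => e) (by simp))
  entails x g hg := by
    have h1 := hg 1 (by simp)
    have : x = op (x 0) • (1 : Fin 1 → R) := by
      ext i
      fin_cases i
      simp
    rw [this, map_smul, h1, smul_zero]

/-- The decomposition of `R ^ (m + n)` as a product. -/
def splitEquiv (R : Type u) [Ring R] (m n : ℕ) :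
    (Fin (m + n) → R) ≃ₗ[Rᵐᵒᵖ] (Fin m → R) × (Fin n → R) :=
  (LinearEquiv.funCongrLeft Rᵐᵒᵖ R finSumFinEquiv).trans
    (LinearEquiv.sumArrowLequivProdArrow (Fin m) (Fin n) Rᵐᵒᵖ R)

/-- In the direct sum, impose both sets of relations and identify the base of `c` with `q`. Exchange
is what keeps the base of `b` from collapsing. -/
theorem Hyperplane.exists_amalgam (hE : EntailsExchange R E) (b c : Hyperplane R E)
    (q : Fin b.rank → R) :
    ∃ (a : Hyperplane R E) (i : (Fin b.rank → R) →ₗ[Rᵐᵒᵖ] (Fin a.rank → R))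
      (j : (Fin c.rank → R) →ₗ[Rᵐᵒᵖ] (Fin a.rank → R)),
      a.base = i b.base ∧ (∀ m ∈ b.rel, i m ∈ a.rel) ∧ (∀ m ∈ c.rel, j m ∈ a.rel) ∧
        i q - j c.base ∈ a.rel := by
  let e := splitEquiv R b.rank c.rank
  let i : (Fin b.rank → R) →ₗ[Rᵐᵒᵖ] (Fin (b.rank + c.rank) → R) :=
    e.symm.toLinearMap ∘ₗ LinearMap.inl _ _ _
  let j : (Fin c.rank → R) →ₗ[Rᵐᵒᵖ] (Fin (b.rank + c.rank) → R) :=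
    e.symm.toLinearMap ∘ₗ LinearMap.inr _ _ _
  have hij : ∀ x, x = i (e x).1 + j (e x).2 := fun x => by
    apply e.injective
    simp [i, j]
  let pb : (Fin (b.rank + c.rank) → R) →ₗ[Rᵐᵒᵖ] (Fin b.rank → R) :=
    LinearMap.fst _ _ _ ∘ₗ e.toLinearMap
  let pc : (Fin (b.rank + c.rank) → R) →ₗ[Rᵐᵒᵖ] (Fin c.rank → R) :=
    LinearMap.snd _ _ _ ∘ₗ e.toLinearMap
  have hbi : ∀ x, pb (i x) = x := fun x => by simp [pb, i]
  have hbj : ∀ x, pb (j x) = 0 := fun x => by simp [pb, j]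
  have hci : ∀ x, pc (i x) = 0 := fun x => by simp [pc, i]
  have hcj : ∀ x, pc (j x) = x := fun x => by simp [pc, j]
  clear_value e i j pb pc
  let S : Set (Fin (b.rank + c.rank) → R) := i '' b.rel ∪ j '' c.rel
  let t := i q - j c.base
  refine ⟨⟨b.rank + c.rank, insert t S, i b.base, fun hent => ?_, fun x g hg => ?_⟩, i, j, rfl,
    fun m hm => Or.inr (Or.inl ⟨m, hm, rfl⟩), fun m hm => Or.inr (Or.inr ⟨m, hm, rfl⟩),
    Or.inl rfl⟩
  · have hu : ¬ Entails R E S (i b.base) := by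
      refine fun h => b.not_entails fun g hg => ?_
      have := h (g ∘ₗ pb) ?_
      · simpa [hbi] using this
      · rintro s (⟨m, hm, rfl⟩ | ⟨m, hm, rfl⟩)
        · simp [hbi, hg m hm]
        · simp [hbj]
    -- Were the base entailed, `t` would be entailed by `S` and `i b.base`; projecting to the second
    -- summand, the relations of `c` would entail its own base.
    have hS := hE _ S t (i b.base) hu hent
    refine c.not_entails fun g hg => ?_
    have := hS (g ∘ₗ pc) ?_
    · simpa [t, hci, hcj] using this
    · rintro s (rfl | ⟨m, hm, rfl⟩ | ⟨m, hm, rfl⟩)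
      · simp [hci]
      · simp [hci]
      · simp [hcj, hg m hm]
  · have h1 : ∀ y, g (i y) = 0 := fun y => by
      refine b.entails y (g ∘ₗ i) ?_
      rintro s (rfl | hs)
      · exact hg _ (Or.inl rfl)
      · exact hg _ (Or.inr (Or.inr (Or.inl ⟨s, hs, rfl⟩)))
    have h2 : ∀ y, g (j y) = 0 := fun y => by
      refine c.entails y (g ∘ₗ j) ?_
      rintro s (rfl | hs)
      · have := hg t (Or.inr (Or.inl rfl))
        rw [map_sub, h1, zero_sub, neg_eq_zero] at this
        exact this
      · exact hg _ (Or.inr (Or.inr (Or.inr ⟨s, hs, rfl⟩)))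
    rw [hij x, map_add, h1, h2, add_zero]

theorem Hyperplane.exists_common_amalgam [Nontrivial E] (hE : EntailsExchange R E)
    (s : Finset (Hyperplane R E)) :
    ∃ a : Hyperplane R E, ∀ b ∈ s, ∃ j : (Fin b.rank → R) →ₗ[Rᵐᵒᵖ] (Fin a.rank → R),
      (∀ m ∈ b.rel, j m ∈ a.rel) ∧ a.base - j b.base ∈ a.rel := by
  classical
  induction s using Finset.induction_on with
  | empty => exact ⟨Hyperplane.unit, by simp⟩
  | insert c s _ ih =>
    obtain ⟨a, ha⟩ := ih
    obtain ⟨a', i, j, hbase, hi, hj, hij⟩ := Hyperplane.exists_amalgam hE a c a.base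
    refine ⟨a', fun b hb => ?_⟩
    rcases Finset.mem_insert.1 hb with rfl | hb
    · exact ⟨j, hj, hbase ▸ hij⟩
    · obtain ⟨k, hk, hk'⟩ := ha b hb
      refine ⟨i ∘ₗ k, fun m hm => hi _ (hk m hm), ?_⟩
      rw [hbase, LinearMap.comp_apply, ← map_sub]
      exact hi _ hk'

/-! ### Simultaneous realization in a reduced power. -/

/-- A separated module in which all hyperplanes are simultaneously realized as kernels, all base
points having the same nonzero value. -/
structure Realization (R : Type u) [Ring R] (E : Type v) [AddCommGroup E] [Module Rᵐᵒᵖ E]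
    (X : Type*) [AddCommGroup X] [Module Rᵐᵒᵖ X] where
  separated : IsSeparated R E X
  /-- The common value of the base points. -/
  one : X
  one_ne_zero : one ≠ 0
  /-- The realization of a hyperplane. -/
  f (b : Hyperplane R E) : (Fin b.rank → R) →ₗ[Rᵐᵒᵖ] X
  f_rel (b : Hyperplane R E) : ∀ m ∈ b.rel, f b m = 0
  f_base (b : Hyperplane R E) : f b b.base = one

/-- By finiteness only finitely many vanishing conditions matter, and these hold together eventually
along the filter. -/
theorem isSeparated_germ (hfin : EntailsFinite R E) {ι : Type*} (l : Filter ι) :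
    IsSeparated R E (l.Germ E) := by
  intro n h S x hS hx
  have hv : ∀ j, ∃ v : ι → E, (v : l.Germ E) = h (Pi.single j 1) := fun j =>
    Quotient.exists_rep (h (Pi.single j 1))
  choose v hv using hv
  have key : ∀ y, h y = ((fun s => ofBasisValues (fun j => v j s) y : ι → E) : l.Germ E) := by
    intro y
    have : (fun s => ofBasisValues (fun j => v j s) y : ι → E) = ∑ j, op (y j) • v j := by
      ext s
      simp [ofBasisValues]
    rw [this, rightLinearMap_apply h y]
    change _ = Filter.Germ.coeAddHom l _
    rw [map_sum]
    exact Finset.sum_congr rfl fun j _ => by rw [← hv]; rfl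
  obtain ⟨T, hTS, hT⟩ := hfin n S
  have hev : ∀ᶠ s in l, ∀ t ∈ T, ofBasisValues (fun j => v j s) t = 0 := by
    rw [Filter.eventually_all_finset]
    intro t ht
    have := hS t (hTS ht)
    rw [key] at this
    exact Filter.Germ.coe_eq.1 this
  rw [key]
  refine Filter.Germ.coe_eq.2 ?_
  filter_upwards [hev] with s hs
  exact hx _ fun k hk => hT k hk _ hs

theorem exists_realization [Nontrivial E] (hE : EntailsExchange R E) (hfin : EntailsFinite R E) :
    Nonempty (Realization R E ((Filter.atTop : Filter (Finset (Hyperplane R E))).Germ E)) := by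
  classical
  have hs : ∀ s : Finset (Hyperplane R E), ∃ (e : E)
      (F : ∀ b : Hyperplane R E, (Fin b.rank → R) →ₗ[Rᵐᵒᵖ] E), e ≠ 0 ∧
        ∀ b ∈ s, (∀ m ∈ b.rel, F b m = 0) ∧ F b b.base = e := by
    intro s
    obtain ⟨a, ha⟩ := Hyperplane.exists_common_amalgam hE s
    have hna := a.not_entails
    simp only [Entails, not_forall] at hna
    obtain ⟨g, hg, hne⟩ := hna
    choose j hj1 hj2 using ha
    -- The value `0` outside `s` disappears in the germ: each hyperplane eventually belongs to `s`.
    refine ⟨g a.base, fun b => if hb : b ∈ s then g ∘ₗ j b hb else 0, hne, fun b hb => ?_⟩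
    simp only [hb, dif_pos, LinearMap.comp_apply]
    refine ⟨fun m hm => hg _ (hj1 b hb m hm), ?_⟩
    have := hg _ (hj2 b hb)
    rw [map_sub, sub_eq_zero] at this
    exact this.symm
  choose e F hne hF using hs
  have hmem : ∀ b : Hyperplane R E, ∀ᶠ s : Finset (Hyperplane R E) in Filter.atTop, b ∈ s :=
    fun b => (Filter.eventually_ge_atTop {b}).mono fun s hs => Finset.singleton_subset_iff.1 hs
  refine ⟨{
    separated := isSeparated_germ hfin _
    one := (e : Filter.Germ _ E)
    one_ne_zero := fun h => ?_
    f := fun b =>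
      { toFun := fun x => ((fun s => F s b x : Finset (Hyperplane R E) → E) : Filter.Germ _ E)
        map_add' := fun x y => by simp only [map_add]; rfl
        map_smul' := fun r x => by simp only [map_smul]; rfl }
    f_rel := fun b m hm => ?_
    f_base := fun b => ?_ }⟩
  · obtain ⟨s, hs⟩ := (Filter.Germ.coe_eq.1 h).exists
    exact hne s hs
  · refine Filter.Germ.coe_eq.2 ?_
    filter_upwards [hmem b] with s hs
    exact (hF s b hs).1 m hm
  · refine Filter.Germ.coe_eq.2 ?_
    filter_upwards [hmem b] with s hs
    exact (hF s b hs).2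

/-! ### Endomorphisms of the realization form a division ring. -/

namespace Realization

variable {X : Type*} [AddCommGroup X] [Module Rᵐᵒᵖ X] (ρ : Realization R E X)

theorem f_comp {a b : Hyperplane R E} (i : (Fin b.rank → R) →ₗ[Rᵐᵒᵖ] (Fin a.rank → R))
    (hrel : ∀ m ∈ b.rel, i m ∈ a.rel) (hbase : ρ.f a (i b.base) = ρ.one) (x : Fin b.rank → R) :
    ρ.f a (i x) = ρ.f b x := by
  have : ρ.f a ∘ₗ i = ρ.f b := by
    refine ρ.separated.ext b (fun m hm => ?_) ?_
    · simp [ρ.f_rel b m hm, ρ.f_rel a _ (hrel m hm)]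
    · simp [hbase, ρ.f_base]
  exact LinearMap.congr_fun this x

theorem exists_common_hyperplane (hE : EntailsExchange R E) (b c : Hyperplane R E) :
    ∃ (a : Hyperplane R E) (i : (Fin b.rank → R) →ₗ[Rᵐᵒᵖ] (Fin a.rank → R))
      (j : (Fin c.rank → R) →ₗ[Rᵐᵒᵖ] (Fin a.rank → R)),
      (∀ m ∈ b.rel, i m ∈ a.rel) ∧ (∀ m ∈ c.rel, j m ∈ a.rel) ∧ a.base = i b.base ∧
        a.base - j c.base ∈ a.rel ∧
        (∀ x, ρ.f a (i x) = ρ.f b x) ∧ ∀ x, ρ.f a (j x) = ρ.f c x := by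
  obtain ⟨a, i, j, h1, h2, h3, h4⟩ := Hyperplane.exists_amalgam hE b c b.base
  refine ⟨a, i, j, h2, h3, h1, h1 ▸ h4, ρ.f_comp i h2 (by rw [← h1, ρ.f_base]),
    ρ.f_comp j h3 ?_⟩
  have := ρ.f_rel a _ h4
  rw [← h1, map_sub, ρ.f_base, sub_eq_zero] at this
  exact this.symm

/-- The submodule of all values of the realizing maps. -/
def values [Nontrivial E] (hE : EntailsExchange R E) : Submodule Rᵐᵒᵖ X where
  carrier := {y | ∃ (b : Hyperplane R E) (x : _), ρ.f b x = y}
  zero_mem' := ⟨Hyperplane.unit, 0, map_zero _⟩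
  add_mem' := by
    rintro _ _ ⟨b, x, rfl⟩ ⟨c, y, rfl⟩
    obtain ⟨a, i, j, -, -, -, -, hi, hj⟩ := ρ.exists_common_hyperplane hE b c
    exact ⟨a, i x + j y, by rw [map_add, hi, hj]⟩
  smul_mem' := by
    rintro r _ ⟨b, x, rfl⟩
    exact ⟨b, r • x, map_smul _ _ _⟩

/-- The realization obtained by restriction to the submodule of values. -/
def restrict [Nontrivial E] (hE : EntailsExchange R E) : Realization R E (ρ.values hE) where
  separated n h S x hS hx :=
    Subtype.ext (ρ.separated n ((ρ.values hE).subtype ∘ₗ h) S x (fun s hs => by simp [hS s hs]) hx)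
  one := ⟨ρ.one, Hyperplane.unit, _, ρ.f_base _⟩
  one_ne_zero h := ρ.one_ne_zero (congrArg Subtype.val h)
  f b := (ρ.f b).codRestrict _ fun x => ⟨b, x, rfl⟩
  f_rel b m hm := Subtype.ext (ρ.f_rel b m hm)
  f_base b := Subtype.ext (ρ.f_base b)

/-- Otherwise exchange puts the base in the closure of the relations and `x`, all killed by `ρ.f b`,
forcing `ρ.one = 0`. -/
theorem entails_of_f_eq_zero (hE : EntailsExchange R E) (b : Hyperplane R E)
    (x : Fin b.rank → R) (hx : ρ.f b x = 0) : Entails R E b.rel x := by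
  by_contra h
  refine ρ.one_ne_zero (ρ.f_base b ▸ ρ.separated _ (ρ.f b) (insert x b.rel) b.base ?_
    (hE _ _ _ _ h (b.entails x)))
  rintro s (rfl | hs)
  · exact hx
  · exact ρ.f_rel b s hs

theorem endomorphism_ext (hsurj : ∀ y, ∃ b x, ρ.f b x = y) {φ ψ : X →ₗ[Rᵐᵒᵖ] X}
    (h : φ ρ.one = ψ ρ.one) : φ = ψ := by
  ext y
  obtain ⟨b, x, rfl⟩ := hsurj y
  have : φ ∘ₗ ρ.f b = ψ ∘ₗ ρ.f b :=
    ρ.separated.ext b (fun m hm => by simp [ρ.f_rel b m hm]) (by simp [ρ.f_base, h])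
  exact LinearMap.congr_fun this x

/-- Write `d` as the value of `ρ.f b` at `q`; amalgamating `b` and `c` along `q` makes the base of
`c` take this value. -/
theorem exists_rescaled_map (hE : EntailsExchange R E) (hsurj : ∀ y, ∃ b x, ρ.f b x = y) (d : X)
    (c : Hyperplane R E) :
    ∃ g : (Fin c.rank → R) →ₗ[Rᵐᵒᵖ] X, (∀ m ∈ c.rel, g m = 0) ∧ g c.base = d := by
  obtain ⟨b, q, rfl⟩ := hsurj d
  obtain ⟨a, i, j, h1, h2, h3, h4⟩ := Hyperplane.exists_amalgam hE b c q
  refine ⟨ρ.f a ∘ₗ j, fun m hm => ρ.f_rel a _ (h3 m hm), ?_⟩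
  have := ρ.f_rel a _ h4
  rw [map_sub, sub_eq_zero] at this
  rw [LinearMap.comp_apply, ← this]
  exact ρ.f_comp i h2 (by rw [← h1, ρ.f_base]) q

theorem exists_endomorphism (hE : EntailsExchange R E) (hsurj : ∀ y, ∃ b x, ρ.f b x = y) (d : X) :
    ∃ φ : X →ₗ[Rᵐᵒᵖ] X, φ ρ.one = d := by
  -- The endomorphism sends `ρ.f c y` to `g c y`. Uniqueness of the rescaled maps makes them
  -- compatible with amalgamation, which reduces well-definedness and additivity to a single
  -- hyperplane.
  choose g hgrel hgbase using ρ.exists_rescaled_map hE hsurj d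
  have hcomp : ∀ (a b : Hyperplane R E) (i : (Fin b.rank → R) →ₗ[Rᵐᵒᵖ] (Fin a.rank → R)),
      (∀ m ∈ b.rel, i m ∈ a.rel) → g a (i b.base) = d → ∀ x, g a (i x) = g b x := by
    intro a b i hi hbase
    refine LinearMap.congr_fun (f := g a ∘ₗ i) (ρ.separated.ext b (fun m hm => ?_) ?_)
    · simp [hgrel b m hm, hgrel a _ (hi m hm)]
    · simp [hbase, hgbase]
  have hamalgam : ∀ b c : Hyperplane R E, ∃ (a : Hyperplane R E)
      (i : (Fin b.rank → R) →ₗ[Rᵐᵒᵖ] (Fin a.rank → R))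
      (j : (Fin c.rank → R) →ₗ[Rᵐᵒᵖ] (Fin a.rank → R)),
      (∀ x, ρ.f a (i x) = ρ.f b x) ∧ (∀ x, ρ.f a (j x) = ρ.f c x) ∧
        (∀ x, g a (i x) = g b x) ∧ ∀ x, g a (j x) = g c x := by
    intro b c
    obtain ⟨a, i, j, h1, h2, h3, h4, h5, h6⟩ := ρ.exists_common_hyperplane hE b c
    refine ⟨a, i, j, h5, h6, hcomp a b i h1 (by rw [← h3, hgbase]), hcomp a c j h2 ?_⟩
    have := hgrel a _ h4
    rw [map_sub, hgbase, sub_eq_zero] at this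
    exact this.symm
  have hwd : ∀ (b c : Hyperplane R E) x y, ρ.f b x = ρ.f c y → g b x = g c y := by
    intro b c x y hxy
    obtain ⟨a, i, j, h1, h2, h3, h4⟩ := hamalgam b c
    rw [← h3, ← h4, ← sub_eq_zero, ← map_sub]
    refine ρ.separated _ (g a) a.rel _ (hgrel a) (ρ.entails_of_f_eq_zero hE a _ ?_)
    rw [map_sub, h1, h2, hxy, sub_self]
  choose b x hx using hsurj
  have hφ : ∀ c y, g (b (ρ.f c y)) (x (ρ.f c y)) = g c y := fun c y => hwd _ _ _ _ (hx _)
  refine ⟨{ toFun := fun y => g (b y) (x y), map_add' := fun y z => ?_,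
            map_smul' := fun r y => ?_ }, ?_⟩
  · obtain ⟨a, i, j, h1, h2, h3, h4⟩ := hamalgam (b y) (b z)
    rw [← h3, ← h4, ← map_add, ← hφ a, map_add, h1, h2, hx, hx]
  · have h := hφ (b y) (r • x y)
    rwa [map_smul, hx, map_smul] at h
  · change g (b ρ.one) (x ρ.one) = d
    rw [← hgbase (b ρ.one), ← hφ (b ρ.one) (b ρ.one).base, ρ.f_base]

theorem exists_endomorphism_mul_eq_one (hE : EntailsExchange R E)
    (hsurj : ∀ y, ∃ b x, ρ.f b x = y) (φ : Module.End Rᵐᵒᵖ X) (hφ : φ ≠ 0) :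
    ∃ ψ : Module.End Rᵐᵒᵖ X, φ * ψ = 1 := by
  obtain ⟨b, q, hq⟩ := hsurj (φ ρ.one)
  have hd : φ ρ.one ≠ 0 := fun h => hφ (ρ.endomorphism_ext hsurj (by simp [h]))
  have hnot : ¬ Entails R E b.rel q := fun h =>
    hd (hq ▸ ρ.separated _ (ρ.f b) _ _ (ρ.f_rel b) h)
  -- Same relations with new base `q`: now `φ` carries `ρ.f b'` to `ρ.f b`, so the value of `ρ.f b'`
  -- at the old base is a preimage of `ρ.one`.
  let b' : Hyperplane R E := ⟨b.rank, b.rel, q, hnot, fun x g hg => by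
    refine b.entails x g ?_
    rintro s (rfl | hs)
    · exact hE _ _ _ _ hnot (b.entails q) g hg
    · exact hg s (Or.inr hs)⟩
  have hb' : φ ∘ₗ ρ.f b' = ρ.f b :=
    ρ.separated.ext b' (fun m hm => by simp [ρ.f_rel b' m hm, ρ.f_rel b m hm])
      (by rw [LinearMap.comp_apply, ρ.f_base b']; exact hq.symm)
  obtain ⟨ψ, hψ⟩ := ρ.exists_endomorphism hE hsurj (ρ.f b' b.base)
  refine ⟨ψ, ρ.endomorphism_ext hsurj ?_⟩
  rw [Module.End.mul_apply, hψ, Module.End.one_apply, ← ρ.f_base b]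
  exact LinearMap.congr_fun hb' b.base

theorem isUnit_or_eq_zero (hE : EntailsExchange R E)
    (hsurj : ∀ y, ∃ b x, ρ.f b x = y) (φ : Module.End Rᵐᵒᵖ X) : IsUnit φ ∨ φ = 0 := by
  refine or_iff_not_imp_right.2 fun hφ => ?_
  have : Nontrivial X := ⟨_, _, ρ.one_ne_zero⟩
  obtain ⟨ψ, hψ⟩ := ρ.exists_endomorphism_mul_eq_one hE hsurj φ hφ
  obtain ⟨χ, hχ⟩ := ρ.exists_endomorphism_mul_eq_one hE hsurj ψ
    (by rintro rfl; simp at hψ)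
  have : φ = χ := by rw [← mul_one φ, ← hχ, ← mul_assoc, hψ, one_mul]
  exact ⟨⟨φ, ψ, hψ, this ▸ hχ⟩, rfl⟩

theorem exists_ringHom (hE : EntailsExchange R E) (hsurj : ∀ y, ∃ b x, ρ.f b x = y) :
    ∃ F : R →+* Module.End Rᵐᵒᵖ X, ∀ r, F r ρ.one = op r • ρ.one := by
  choose F hF using fun r : R => ρ.exists_endomorphism hE hsurj (op r • ρ.one)
  refine ⟨⟨⟨⟨F, ?_⟩, fun r s => ?_⟩, ?_, fun r s => ?_⟩, hF⟩ <;>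
    refine ρ.endomorphism_ext hsurj ?_
  · simp [hF]
  · simp [hF, mul_smul]
  · simp [hF]
  · simp [hF, add_smul]

theorem eq_zero_of_smul_one_eq_zero [Nontrivial E] (hE : EntailsExchange R E)
    (hfaith : ∀ r : R, (∀ e : E, op r • e = 0) → r = 0) {r : R} (hr : op r • ρ.one = 0) :
    r = 0 := by
  refine hfaith r fun e => ?_
  have h := ρ.entails_of_f_eq_zero hE Hyperplane.unit (op r • Hyperplane.unit.base)
    (by rw [map_smul, ρ.f_base, hr])
  have := h (ofBasisValues fun _ => e) (fun s hs => hs.elim)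
  have hbase : ofBasisValues (fun _ => e) (Hyperplane.unit (R := R) (E := E)).base = e := by
    change ofBasisValues (n := 1) (fun _ => e) (1 : Fin 1 → R) = e
    simp [ofBasisValues]
  rwa [map_smul, hbase] at this

end Realization

theorem exists_embedding_divisionRing [Nontrivial E] (hE : EntailsExchange R E)
    (hfin : EntailsFinite R E) (hfaith : ∀ r : R, (∀ e : E, op r • e = 0) → r = 0) :
    ∃ (D : Type u) (_ : DivisionRing D) (f : R →+* D), Function.Injective f := by
  obtain ⟨ρ₀⟩ := exists_realization hE hfin
  let ρ := ρ₀.restrict hE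
  have hsurj : ∀ y, ∃ b x, ρ.f b x = y := by
    rintro ⟨_, b, x, rfl⟩
    exact ⟨b, x, rfl⟩
  -- Hyperplanes and their vectors live in universe `u` even though `E` does not, so the division
  -- ring can be shrunk to the universe of `R`.
  have hsmall : Small.{u} (ρ₀.values hE) :=
    small_of_surjective (α := Σ b : Hyperplane R E, (Fin b.rank → R))
      (f := fun z => ρ.f z.1 z.2) fun y => by
        obtain ⟨b, x, h⟩ := hsurj y
        exact ⟨⟨b, x⟩, h⟩
  have : Small.{u} (Module.End Rᵐᵒᵖ (ρ₀.values hE)) :=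
    small_of_injective (f := fun φ => φ ρ.one) fun φ ψ h => ρ.endomorphism_ext hsurj h
  have : Nontrivial (ρ₀.values hE) := ⟨_, _, ρ.one_ne_zero⟩
  let _ : DivisionRing (Module.End Rᵐᵒᵖ (ρ₀.values hE)) :=
    DivisionRing.ofIsUnitOrEqZero (ρ.isUnit_or_eq_zero hE hsurj)
  obtain ⟨F, hF⟩ := ρ.exists_ringHom hE hsurj
  refine ⟨Shrink.{u} (Module.End Rᵐᵒᵖ (ρ₀.values hE)), inferInstance,
    (Shrink.ringEquiv _).symm.toRingHom.comp F, ?_⟩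
  refine (Shrink.ringEquiv _).symm.injective.comp ((injective_iff_map_eq_zero F).2 fun r hr => ?_)
  refine ρ.eq_zero_of_smul_one_eq_zero hE hfaith ?_
  rw [← hF, hr, LinearMap.zero_apply]

end Fractions

/-! ### Character duality between closure and entailment. -/

section Dual

open MulOpposite

variable {R : Type u} [Ring R] {L : Type v} [AddCommGroup L] [Module R L]

/-- The right module of characters of a left module. -/
def RightDual (L : Type v) [AddCommGroup L] : Type v := L →+ AddCircle (1 : ℚ)

instance : AddCommGroup (RightDual L) :=
  inferInstanceAs (AddCommGroup (L →+ AddCircle (1 : ℚ)))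

/-- The value of a character. -/
def RightDual.eval (χ : RightDual L) : L →+ AddCircle (1 : ℚ) := χ

theorem RightDual.ext {L : Type v} [AddCommGroup L] {χ ψ : RightDual L} (h : ∀ l, χ.eval l = ψ.eval l) : χ = ψ :=
  DFunLike.ext (F := L →+ AddCircle (1 : ℚ)) _ _ h

theorem exists_character_ne_zero {A : Type*} [AddCommGroup A] (B : AddSubgroup A) {a : A}
    (ha : a ∉ B) : ∃ χ : A →+ AddCircle (1 : ℚ), (∀ b ∈ B, χ b = 0) ∧ χ a ≠ 0 := by
  have : (QuotientAddGroup.mk a : A ⧸ B) ≠ 0 := by rwa [Ne, QuotientAddGroup.eq_zero_iff]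
  obtain ⟨χ, hχ⟩ := CharacterModule.exists_character_apply_ne_zero_of_ne_zero this
  let ψ : (A ⧸ B) →+ AddCircle (1 : ℚ) := χ
  refine ⟨ψ.comp (QuotientAddGroup.mk' B), fun b hb => ?_, hχ⟩
  have hb0 : QuotientAddGroup.mk' B b = 0 := (QuotientAddGroup.eq_zero_iff b).2 hb
  rw [AddMonoidHom.comp_apply, hb0, map_zero]

theorem exists_character_apply_ne_zero {L : Type v} [AddCommGroup L] {l : L} (hl : l ≠ 0) :
    ∃ χ : RightDual L, χ.eval l ≠ 0 := by
  obtain ⟨χ, -, hχ⟩ := exists_character_ne_zero (⊥ : AddSubgroup L) (a := l) (by simpa using hl)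
  exact ⟨χ, hχ⟩

instance : Module Rᵐᵒᵖ (RightDual L) where
  smul r χ := χ.eval.comp (DistribSMul.toAddMonoidHom L r.unop)
  one_smul χ := DFunLike.ext (F := L →+ AddCircle (1 : ℚ)) _ _ fun l =>
    congrArg χ.eval (one_smul R l)
  mul_smul r s χ := DFunLike.ext (F := L →+ AddCircle (1 : ℚ)) _ _ fun l =>
    congrArg χ.eval (mul_smul s.unop r.unop l)
  smul_zero _ := rfl
  smul_add _ _ _ := rfl
  add_smul r s χ := DFunLike.ext (F := L →+ AddCircle (1 : ℚ)) _ _ fun l =>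
    (congrArg χ.eval (add_smul r.unop s.unop l)).trans (map_add _ _ _)
  zero_smul χ := DFunLike.ext (F := L →+ AddCircle (1 : ℚ)) _ _ fun l =>
    (congrArg χ.eval (zero_smul R l)).trans (map_zero _)

variable (R) in
/-- The right linear map `x ↦ (l ↦ χ (x l))` given by a character of `L ^ n`. -/
def dualMap {n : ℕ} (χ : (Fin n → L) →+ AddCircle (1 : ℚ)) :
    (Fin n → R) →ₗ[Rᵐᵒᵖ] RightDual L where
  toFun x := χ.comp (colMap L x)
  map_add' x y := RightDual.ext fun l => by
    have : colMap L (x + y) l = colMap L x l + colMap L y l := by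
      ext i; simp [colMap, add_smul]
    exact (congrArg χ this).trans (map_add _ _ _)
  map_smul' r x := RightDual.ext fun l => by
    have : colMap L (r • x) l = colMap L x (r.unop • l) := by
      ext i; simp [colMap, mul_smul]
    exact congrArg χ this

/-- The images of the basis columns are `n` characters of `L`, which add up to one character of `L ^
n`. -/
theorem exists_eq_dualMap {n : ℕ} (g : (Fin n → R) →ₗ[Rᵐᵒᵖ] RightDual L) :
    ∃ χ, g = dualMap R χ := by
  refine ⟨∑ j, (g (Pi.single j 1)).eval.comp (Pi.evalAddMonoidHom _ j), ?_⟩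
  refine LinearMap.ext fun x => ?_
  refine RightDual.ext fun l => ?_
  have hsum : ∀ (s : Finset (Fin n)) (F : Fin n → RightDual L),
      (∑ j ∈ s, F j).eval l = ∑ j ∈ s, (F j).eval l := fun s F =>
    map_sum (AddMonoidHom.mk' (fun χ : RightDual L => χ.eval l) fun _ _ => rfl) F s
  rw [rightLinearMap_apply g x, hsum]
  change _ = (∑ j, (g (Pi.single j 1)).eval.comp (Pi.evalAddMonoidHom _ j) :
    (Fin n → L) →+ AddCircle (1 : ℚ)) (colMap L x l)
  rw [AddMonoidHom.finsetSum_apply]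
  rfl

theorem dualMap_eq_zero_iff {n : ℕ} (χ : (Fin n → L) →+ AddCircle (1 : ℚ)) (x : Fin n → R) :
    dualMap R χ x = 0 ↔ colImage L x ≤ χ.ker := by
  constructor
  · rintro h _ ⟨l, rfl⟩
    exact congrArg (fun ψ => RightDual.eval ψ l) h
  · exact fun h => RightDual.ext fun l => h ⟨l, rfl⟩

theorem mem_clL_iff_entails {n : ℕ} (S : Set (Fin n → R)) (x : Fin n → R) :
    x ∈ clL L n S ↔ Entails R (RightDual L) S x := by
  constructor
  · intro hx g hg
    obtain ⟨χ, rfl⟩ := exists_eq_dualMap g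
    rw [dualMap_eq_zero_iff]
    refine le_trans (show colImage L x ≤ _ from hx) ((sumImage_le L).2 fun s hs => ?_)
    exact (dualMap_eq_zero_iff χ s).1 (hg s hs)
  · rintro hx _ ⟨l, rfl⟩
    by_contra h
    obtain ⟨χ, hχ, hne⟩ := exists_character_ne_zero _ h
    refine hne ((dualMap_eq_zero_iff χ x).1 (hx _ fun s hs => ?_) ⟨l, rfl⟩)
    exact (dualMap_eq_zero_iff χ s).2 fun y hy => hχ y (colImage_le_sumImage L hs hy)

variable (R L) in
theorem exists_embedding_of_exchange [Nontrivial L] [FaithfulSMul R L]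
    (hex : ∀ n, Exchange (clL (R := R) L n)) :
    ∃ (D : Type u) (_ : DivisionRing D) (f : R →+* D), Function.Injective f := by
  have : Nontrivial (RightDual L) := by
    obtain ⟨l, hl⟩ := exists_ne (0 : L)
    obtain ⟨χ, hχ⟩ := exists_character_apply_ne_zero hl
    exact ⟨χ, 0, by rintro rfl; exact hχ rfl⟩
  refine exists_embedding_divisionRing (E := RightDual L) (fun n S t u => ?_) (fun n K => ?_)
    fun r hr => ?_
  · simp only [← mem_clL_iff_entails, ← Set.union_singleton]
    exact hex n S t u
  · obtain ⟨T₀, hT₀, htop⟩ := exists_finset_clL_eq_univ (R := R) L n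
    obtain ⟨T, hTK, hT, -⟩ := ExchangeBelow.exists_finset_subset (isClosureOperator_clL L n)
      (n := n) (fun S t u _ => hex n S t u) T₀ hT₀ htop K
    exact ⟨T, hTK, fun k hk => (mem_clL_iff_entails _ _).1 (hT hk)⟩
  · refine FaithfulSMul.eq_of_smul_eq_smul (α := L) fun l => ?_
    rw [zero_smul]
    by_contra hl
    obtain ⟨χ, hχ⟩ := exists_character_apply_ne_zero hl
    exact hχ (congrArg (fun ψ => RightDual.eval ψ l) (hr χ))

end Dual

end ClosureStructures

theorem lemmaL (R : Type u) [Ring R] (L : Type v) [AddCommGroup L] [Module R L] [Nontrivial L] :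
    (∀ n : ℕ, ClosureStructures.ClosureCondition (R := R) (ClosureStructures.clL L n)) ∧
    ClosureStructures.Properness (R := R) (ClosureStructures.clL L) ∧
    ClosureStructures.Coherence (R := R) (ClosureStructures.clL L) ∧
    (∀ n : ℕ, List.TFAE
      [ClosureStructures.Exchange (ClosureStructures.clL (R := R) L n),
       ClosureStructures.ExchangeBelow n (ClosureStructures.clL (R := R) L n),
       ClosureStructures.NoChainOfSets R L n,
       ClosureStructures.NoChainOfAddedColumns R L n,
       ClosureStructures.NoChainOfSquareMatrices R L n]) ∧
    (FaithfulSMul R L →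
      ((∀ n : ℕ, ClosureStructures.NoChainOfSets R L n) ∨
        (∀ n : ℕ, ClosureStructures.NoChainOfAddedColumns R L n) ∨
        (∀ n : ℕ, ClosureStructures.NoChainOfSquareMatrices R L n)) →
      ∃ (D : Type u) (_ : DivisionRing D) (f : R →+* D), Function.Injective f) := by
  have htfae := ClosureStructures.exchange_clL_tfae (R := R) L
  refine ⟨ClosureStructures.closureCondition_clL L, ClosureStructures.properness_clL L,
    ClosureStructures.coherence_clL L, htfae, fun _ h => ?_⟩
  refine ClosureStructures.exists_embedding_of_exchange R L fun n => ?_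
  rcases h with h | h | h
  · exact ((htfae n).out 0 2).2 (h n)
  · exact ((htfae n).out 0 3).2 (h n)
  · exact ((htfae n).out 0 4).2 (h n)
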